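/- Let $G_r$ and $G_c$ be undirected weighted graphs (symmetric, nonnegative weights) on the vertex sets $\{1,\dots,p\}$ and $\{1,\dots,n\}$, and let $\mathcal L_r\in\mathbb R^{p\times p}$, $\mathcal L_c\in\mathbb R^{n\times n}$ be their graph Laplacians (combinatorial, $D-W$, or normalized, $D^{-1/2}(D-W)D^{-1/2}$, where $W$ is the weight matrix and $D$ the diagonal matrix of degrees). Let $\mathcal L_r=P\Lambda_rP^\top$ and $\mathcal L_c=Q\Lambda_cQ^\top$ with $P,Q$ orthogonal and $\Lambda_r,\Lambda_c$ diagonal with entries sorted in increasing order. For $k_r\le p$ and $k_c\le n$ let $P_{k_r}$ and $Q_{k_c}$ consist of the first $k_r$ columns of $P$ and the first $k_c$ columns of $Q$. Let $\mathcal{LR}(P_{k_r},Q_{k_c})$ be the set of matrices $Y\in\mathbb R^{p\times n}$ whose columns all lie in $\mathrm{span}(P_{k_r})$ and whose rows all lie in $\mathrm{span}(Q_{k_c})$ (spans of the columns). Define the cumulative coherences $$\nu_{k_c}=\max_{1\le i\le n}\sqrt n\,\|Q_{k_c}^\top e_i\|_2,\qquad \nu_{k_r}=\max_{1\le j\le p}\sqrt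 p\,\|P_{k_r}^\top e_j\|_2,$$ where $e_i$ denotes the $i$-th standard basis vector (of $\mathbb R^n$, respectively $\mathbb R^p$). Let $\omega^r_1,\dots,\omega^r_{\rho_r}$ be indices drawn uniformly without replacement from $\{1,\dots,p\}$, and let $\omega^c_1,\dots,\omega^c_{\rho_c}$ be indices drawn uniformly without replacement from $\{1,\dots,n\}$. Let $M_r\in\{0,1\}^{\rho_r\times p}$ have entries $(M_r)_{ij}=1$ if and only if $j=\omega^r_i$, and let $M_c\in\{0,1\}^{n\times\rho_c}$ have entries $(M_c)_{ij}=1$ if and only if $i=\omega^c_j$. Then for any $\delta,\epsilon\in(0,1)$ such that $$\rho_c\ge\frac{27}{\delta^2}\,\nu_{k_c}^2\log\Big(\frac{4k_c}{\epsilon}\Big)\quad\text{and}\quad \rho_r\ge\frac{27}{\delta^2}\,\nu_{k_r}^2\log\Big(\frac{4k_r}{\epsilon}\Big),$$ with probability at least $1-\epsilon$ one has, simultaneously for all $Y\in\mathcal{LR}(P_{k_r},Q_{k_c})$, $$(1-\delta)\|Y\|_F^2\le\frac{np}{\rho_r\rho_c}\|M_rYM_c\|_F^2\le(1+\delta)\|Y\|_F^2,$$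 where $\|\cdot\|_F$ is the Frobenius norm. -/

import Mathlib

open MeasureTheory ProbabilityTheory

attribute [local instance] Matrix.frobeniusNormedAddCommGroup

noncomputable section

/-- A finite undirected weighted graph on the vertex set `V`, given by its symmetric weighted
adjacency matrix with nonnegative entries. -/
structure WeightedGraph (V : Type*) where
  W : Matrix V V ℝ
  symm : ∀ i j, W i j = W j i
  nonneg : ∀ i j, 0 ≤ W i j

namespace WeightedGraph

variable {V : Type*} [Fintype V] [DecidableEq V]

/-- The degree `D i i = ∑ j, W i j` of a vertex. -/
def degree (G : WeightedGraph V) (i : V) : ℝ := ∑ j, G.W i j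

/-- The combinatorial Laplacian `D - W`. -/
def laplacian (G : WeightedGraph V) : Matrix V V ℝ := Matrix.diagonal G.degree - G.W

/-- The normalized Laplacian `D ^ (-1/2) (D - W) D ^ (-1/2)`, with the usual convention that
`D ^ (-1/2)` vanishes at the isolated vertices. -/
def normalizedLaplacian (G : WeightedGraph V) : Matrix V V ℝ :=
  Matrix.diagonal (fun i => (√(G.degree i))⁻¹) * G.laplacian *
    Matrix.diagonal (fun i => (√(G.degree i))⁻¹)

/-- `L` is a Laplacian of `G`, either the combinatorial or the normalized one. -/
def IsLaplacian (G : WeightedGraph V) (L : Matrix V V ℝ) : Prop :=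
  L = G.laplacian ∨ L = G.normalizedLaplacian

end WeightedGraph

/-- `L = Q Λ Qᵀ` with `Q` orthogonal and `Λ = diag(lam 0, ..., lam (n-1))` sorted in increasing
order. The columns of `Q` are the (Fourier) eigenvectors of `L`. -/
structure IsSortedEigendecomposition {n : ℕ} (L Q : Matrix (Fin n) (Fin n) ℝ)
    (lam : Fin n → ℝ) : Prop where
  orthogonal : Q ∈ Matrix.orthogonalGroup (Fin n) ℝ
  sorted : Monotone lam
  eq : L = Q * Matrix.diagonal lam * Q.transpose

/-- The `n × k` matrix `Q_k` made of the first `k` columns of `Q`. -/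
def firstCols {n : ℕ} (Q : Matrix (Fin n) (Fin n) ℝ) (k : ℕ) (hk : k ≤ n) :
    Matrix (Fin n) (Fin k) ℝ :=
  Q.submatrix id (Fin.castLE hk)

/-- The span of the columns of a matrix. -/
def colSpan {n k : ℕ} (A : Matrix (Fin n) (Fin k) ℝ) : Submodule ℝ (Fin n → ℝ) :=
  Submodule.span ℝ (Set.range A.col)

/-- The cumulative coherence `max_i √n ‖Q_kᵀ Δ_i‖₂`, where `Δ_i` is the indicator vector of
the vertex `i` and `‖·‖₂` is the Euclidean norm. (The supremum of finitely many reals is their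
maximum.) -/
def cumulativeCoherence {n k : ℕ} (Qk : Matrix (Fin n) (Fin k) ℝ) : ℝ :=
  ⨆ i : Fin n, √(n : ℝ) * ‖WithLp.toLp 2 (Qk.transpose.mulVec (Pi.single i 1))‖

/-- The set of `p × n` matrices all of whose columns lie in `span(P_k)` and all of whose rows
lie in `span(Q_k)`. -/
def lowRankOnGraphs {p n kr kc : ℕ} (Pk : Matrix (Fin p) (Fin kr) ℝ)
    (Qk : Matrix (Fin n) (Fin kc) ℝ) : Set (Matrix (Fin p) (Fin n) ℝ) :=
  {Y | (∀ j, Y.col j ∈ colSpan Pk) ∧ (∀ i, Y.row i ∈ colSpan Qk)}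

/-- The `ρ × p` row subsampling matrix: entry `(i, j)` is `1` if `j = ω i` and `0` otherwise. -/
def rowSampling {ρ p : ℕ} (ω : Fin ρ → Fin p) : Matrix (Fin ρ) (Fin p) ℝ :=
  Matrix.of fun i j => if j = ω i then 1 else 0

/-- The `n × ρ` column subsampling matrix: entry `(i, j)` is `1` if `i = ω j` and `0`
otherwise. -/
def colSampling {ρ n : ℕ} (ω : Fin ρ → Fin n) : Matrix (Fin n) (Fin ρ) ℝ :=
  Matrix.of fun i j => if i = ω j then 1 else 0

/-- The random tuple `(ω 0, ..., ω (ρ-1))` consists of `ρ` indices drawn uniformly without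
replacement from `n`: its law is the uniform law on the injective tuples. (Such a random tuple
exists on a probability space only if `ρ ≤ n`.) -/
def IsUniformWithoutReplacement {S : Type*} [MeasurableSpace S] (μ : Measure S) {ρ n : ℕ}
    (ω : S → Fin ρ → Fin n) : Prop :=
  HasLaw ω (uniformOn {f : Fin ρ → Fin n | Function.Injective f}) μ

end

/-! ### The trace exponential under rank-one perturbations -/

section TraceExp

open Matrix

/-! The problem decouples into rows and columns. Suppose that for each of the two spans the rescaled
sampled coordinates carry the energy of every vector up to the factors `1 - δ / 2` and `1 + 0.414 *
δ`. Using this along the columns of `Y` and then along its rows squares the factors, and the squares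
lie in `[1 - δ, 1 + δ]`. The two draws meet only in a union bound, so their joint law is irrelevant.

For one side, let `q j` be the rows of the matrix of the first `k` eigenvectors: `∑ q qᵀ = 1`, and
`|q j|² ≤ R` with `n * R = ν²`. The sampled energy is the quadratic form of `∑ i, q (e i) q (e i)ᵀ`,
and a Chernoff argument controls its extreme Rayleigh quotients by averaging `tr exp` of `θ` times
this matrix over injective samples `e`. By convexity, one more draw without replacement costs at
most one with replacement (`card_mul_sum_embedding_succ_le`). A draw with replacement multiplies the
average by at most `1 + θ exp(θR) / n` (`sum_trace_exp_add_smul_vecMulVec_le`), which follows from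
Klein's inequality and a power series comparison (`dotProduct_add_vecMulVec_pow_le`). Suitable `θ`
of either sign make each tail at most `ε / 4`. -/

theorem isHermitian_smul_vecMulVec {κ : Type*} (s : ℝ) (x : κ → ℝ) : (s • vecMulVec x x).IsHermitian := by
  ext i j
  simp [vecMulVec_apply, mul_comm]

theorem pow_eq_pow_add_sum_range {R : Type*} [Ring R] (a b : R) (N : ℕ) :
    b ^ N = a ^ N + ∑ i ∈ Finset.range N, a ^ (N - 1 - i) * (b - a) * b ^ i := by
  induction N with
  | zero => simp
  | succ N ih =>
    rw [Finset.sum_range_succ]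
    have : ∑ i ∈ Finset.range N, a ^ (N + 1 - 1 - i) * (b - a) * b ^ i =
        a * ∑ i ∈ Finset.range N, a ^ (N - 1 - i) * (b - a) * b ^ i := by
      rw [Finset.mul_sum]
      refine Finset.sum_congr rfl fun i hi => ?_
      have : N + 1 - 1 - i = (N - 1 - i) + 1 := by
        have := Finset.mem_range.1 hi; omega
      rw [this, pow_succ']
      simp only [mul_assoc]
    rw [this, add_tsub_cancel_right, Nat.sub_self, pow_zero, one_mul, pow_succ', pow_succ',
      ← add_assoc, ← mul_add, ← ih]
    noncomm_ring

variable {ι : Type*} [Fintype ι]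

/-- A weighted Chebyshev sum inequality. -/
theorem sum_mul_sum_le_sum_mul_sum_of_monovary {w f g : ι → ℝ} (hw : ∀ i, 0 ≤ w i)
    (hfg : Monovary f g) :
    (∑ i, f i * w i) * ∑ i, g i * w i ≤ (∑ i, w i) * ∑ i, f i * g i * w i := by
  have h : 0 ≤ ∑ i, ∑ j, w i * w j * ((f i - f j) * (g i - g j)) :=
    Finset.sum_nonneg fun i _ => Finset.sum_nonneg fun j _ =>
      mul_nonneg (mul_nonneg (hw i) (hw j)) (monovary_iff_forall_mul_nonneg.1 hfg j i)
  have e : ∑ i, ∑ j, w i * w j * ((f i - f j) * (g i - g j)) =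
      (∑ i, f i * g i * w i) * (∑ j, w j) + (∑ i, w i) * (∑ j, f j * g j * w j)
        - (∑ i, f i * w i) * (∑ j, g j * w j) - (∑ i, g i * w i) * (∑ j, f j * w j) := by
    simp_rw [Finset.sum_mul_sum, ← Finset.sum_add_distrib, ← Finset.sum_sub_distrib]
    exact Finset.sum_congr rfl fun i _ => Finset.sum_congr rfl fun j _ => by ring
  rw [e] at h
  nlinarith

theorem hasSum_sum_exp_mul (a w : ι → ℝ) :
    HasSum (fun N : ℕ => (N.factorial : ℝ)⁻¹ * ∑ i, a i ^ N * w i)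
      (∑ i, Real.exp (a i) * w i) := by
  simp_rw [Finset.mul_sum]
  refine hasSum_sum fun i _ => ?_
  have := (NormedSpace.exp_series_hasSum_exp' (𝕂 := ℝ) (a i)).mul_right (w i)
  rw [← Real.exp_eq_exp_ℝ] at this
  simpa [mul_assoc] using this

theorem dotProduct_mul_vecMulVec_mul (A B : Matrix ι ι ℝ) (x : ι → ℝ) :
    x ⬝ᵥ (A * vecMulVec x x * B) *ᵥ x = (x ⬝ᵥ A *ᵥ x) * (x ⬝ᵥ B *ᵥ x) := by
  rw [← Matrix.mulVec_mulVec, ← Matrix.mulVec_mulVec, vecMulVec_mulVec, op_smul_eq_smul,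
    mulVec_smul, dotProduct_smul, smul_eq_mul, mul_comm]

variable [DecidableEq ι]

theorem exists_orthogonal_diagonalization {A : Matrix ι ι ℝ} (hA : A.IsHermitian) :
    ∃ (U : Matrix ι ι ℝ) (a : ι → ℝ), U * Uᵀ = 1 ∧ Uᵀ * U = 1 ∧ A = U * diagonal a * Uᵀ := by
  refine ⟨hA.eigenvectorUnitary, hA.eigenvalues, ?_, ?_, ?_⟩
  · exact (Matrix.mem_unitaryGroup_iff).1 hA.eigenvectorUnitary.2
  · exact (Matrix.mem_unitaryGroup_iff').1 hA.eigenvectorUnitary.2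
  · conv_lhs => rw [hA.spectral_theorem]
    rfl

theorem exp_orthogonal_conj {U : Matrix ι ι ℝ} (hU : U * Uᵀ = 1) (a : ι → ℝ) :
    NormedSpace.exp (U * diagonal a * Uᵀ) = U * diagonal (fun i => Real.exp (a i)) * Uᵀ := by
  have hinv : U⁻¹ = Uᵀ := Matrix.inv_eq_right_inv hU
  have hunit : IsUnit U := IsUnit.of_mul_eq_one _ hU
  rw [← hinv, Matrix.exp_conj U _ hunit, Matrix.exp_diagonal]
  congr 3
  ext i
  rw [Pi.coe_exp, Real.exp_eq_exp_ℝ]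

theorem pow_orthogonal_conj {U : Matrix ι ι ℝ} (hU : U * Uᵀ = 1) (hU' : Uᵀ * U = 1)
    (a : ι → ℝ) (N : ℕ) :
    (U * diagonal a * Uᵀ) ^ N = U * diagonal (fun i => a i ^ N) * Uᵀ := by
  induction N with
  | zero => simp [hU]
  | succ N ih =>
    rw [pow_succ, ih]
    calc _ = U * diagonal (fun i => a i ^ N) * (Uᵀ * U) * diagonal a * Uᵀ := by
          simp only [Matrix.mul_assoc]
      _ = _ := by
          rw [hU', Matrix.mul_one, Matrix.mul_assoc U, diagonal_mul_diagonal]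
          simp [pow_succ]

theorem dotProduct_orthogonal_conj (U : Matrix ι ι ℝ) (a x : ι → ℝ) :
    x ⬝ᵥ (U * diagonal a * Uᵀ) *ᵥ x = ∑ i, a i * (Uᵀ *ᵥ x) i ^ 2 := by
  rw [← Matrix.mulVec_mulVec, ← Matrix.mulVec_mulVec, dotProduct_mulVec, ← mulVec_transpose,
    dotProduct]
  refine Finset.sum_congr rfl fun i _ => ?_
  rw [mulVec_diagonal]
  ring

theorem trace_orthogonal_conj {U : Matrix ι ι ℝ} (hU : Uᵀ * U = 1) (a : ι → ℝ) :
    (U * diagonal a * Uᵀ).trace = ∑ i, a i := by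
  rw [Matrix.trace_mul_comm, ← Matrix.mul_assoc, hU, Matrix.one_mul, trace_diagonal]

theorem trace_mul_orthogonal_conj (U V : Matrix ι ι ℝ) (a b : ι → ℝ) :
    ((U * diagonal a * Uᵀ) * (V * diagonal b * Vᵀ)).trace =
      ∑ i, ∑ j, a i * b j * (Uᵀ * V) i j ^ 2 := by
  have h : ((U * diagonal a * Uᵀ) * (V * diagonal b * Vᵀ)).trace =
      ((diagonal a * (Uᵀ * V)) * (diagonal b * (Uᵀ * V)ᵀ)).trace := by
    rw [transpose_mul, transpose_transpose]
    simp only [Matrix.mul_assoc]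
    rw [Matrix.trace_mul_comm U]
    simp only [Matrix.mul_assoc]
  rw [h, Matrix.trace]
  refine Finset.sum_congr rfl fun i _ => ?_
  rw [diag_apply, Matrix.mul_apply]
  refine Finset.sum_congr rfl fun j _ => ?_
  rw [diagonal_mul, diagonal_mul, transpose_apply]
  ring

/-- Klein's inequality for the exponential. -/
theorem trace_exp_add_trace_exp_mul_sub_le {A B : Matrix ι ι ℝ} (hA : A.IsHermitian)
    (hB : B.IsHermitian) :
    (NormedSpace.exp A).trace + (NormedSpace.exp A * (B - A)).trace ≤
      (NormedSpace.exp B).trace := by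
  obtain ⟨U, a, hU, hU', rfl⟩ := exists_orthogonal_diagonalization hA
  obtain ⟨V, b, hV, hV', rfl⟩ := exists_orthogonal_diagonalization hB
  -- The squared entries of `Uᵀ * V` are doubly stochastic weights, so the claim is a weighted sum
  -- of the tangent line inequalities `exp a * (1 + b - a) ≤ exp b`.
  have hrow : ∀ i, ∑ j, (Uᵀ * V) i j ^ 2 = 1 := fun i => by
    have h : (Uᵀ * V) * (Uᵀ * V)ᵀ = 1 := by
      rw [transpose_mul, transpose_transpose, Matrix.mul_assoc, ← Matrix.mul_assoc V, hV,
        Matrix.one_mul, hU']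
    have := congrFun (congrFun h i) i
    rw [Matrix.mul_apply, one_apply_eq] at this
    simpa [sq] using this
  have hcol : ∀ j, ∑ i, (Uᵀ * V) i j ^ 2 = 1 := fun j => by
    have h : (Uᵀ * V)ᵀ * (Uᵀ * V) = 1 := by
      rw [transpose_mul, transpose_transpose, Matrix.mul_assoc, ← Matrix.mul_assoc U, hU,
        Matrix.one_mul, hV']
    have := congrFun (congrFun h j) j
    rw [Matrix.mul_apply, one_apply_eq] at this
    simpa [sq] using this
  have hAA : ((U * diagonal (fun i => Real.exp (a i)) * Uᵀ) * (U * diagonal a * Uᵀ)).trace =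
      ∑ i, Real.exp (a i) * a i := by
    have : (U * diagonal (fun i => Real.exp (a i)) * Uᵀ) * (U * diagonal a * Uᵀ) =
        U * diagonal (fun i => Real.exp (a i) * a i) * Uᵀ := by
      rw [← diagonal_mul_diagonal]
      calc _ = U * diagonal (fun i => Real.exp (a i)) * (Uᵀ * U) * diagonal a * Uᵀ := by
            simp only [Matrix.mul_assoc]
        _ = _ := by rw [hU', Matrix.mul_one]; simp only [Matrix.mul_assoc]
    rw [this, trace_orthogonal_conj hU']
  rw [exp_orthogonal_conj hU, exp_orthogonal_conj hV, Matrix.mul_sub, trace_sub,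
    trace_mul_orthogonal_conj, hAA, trace_orthogonal_conj hU', trace_orthogonal_conj hV']
  have e1 : ∑ i, Real.exp (a i) = ∑ i, ∑ j, Real.exp (a i) * (Uᵀ * V) i j ^ 2 := by
    simp_rw [← Finset.mul_sum, hrow, mul_one]
  have e2 : ∑ i, Real.exp (a i) * a i =
      ∑ i, ∑ j, Real.exp (a i) * a i * (Uᵀ * V) i j ^ 2 := by
    simp_rw [← Finset.mul_sum, hrow, mul_one]
  have e3 : ∑ j, Real.exp (b j) = ∑ i, ∑ j, Real.exp (b j) * (Uᵀ * V) i j ^ 2 := by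
    rw [Finset.sum_comm]
    simp_rw [← Finset.mul_sum, hcol, mul_one]
  rw [e1, e2, e3]
  simp_rw [← Finset.sum_sub_distrib, ← Finset.sum_add_distrib]
  refine Finset.sum_le_sum fun i _ => Finset.sum_le_sum fun j _ => ?_
  have h1 : Real.exp (a i) * (1 + (b j - a i)) ≤ Real.exp (b j) := by
    have h2 := Real.add_one_le_exp (b j - a i)
    calc _ ≤ Real.exp (a i) * Real.exp (b j - a i) := by
          gcongr; linarith
      _ = _ := by rw [← Real.exp_add]; congr 1; ring
  nlinarith [mul_le_mul_of_nonneg_right h1 (sq_nonneg ((Uᵀ * V) i j))]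

/-- Midpoint convexity: add Klein's inequality for `D` and for `-D`; the first-order terms cancel.
-/
theorem two_mul_trace_exp_le {A D : Matrix ι ι ℝ} (hA : A.IsHermitian) (hD : D.IsHermitian) :
    2 * (NormedSpace.exp A).trace ≤
      (NormedSpace.exp (A + D)).trace + (NormedSpace.exp (A - D)).trace := by
  have h1 := trace_exp_add_trace_exp_mul_sub_le hA (hA.add hD)
  have h2 := trace_exp_add_trace_exp_mul_sub_le hA (hA.sub hD)
  have e1 : A + D - A = D := by abel
  have e2 : A - D - A = -D := by abel
  rw [e1] at h1
  rw [e2, Matrix.mul_neg, trace_neg] at h2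
  linarith

theorem trace_exp_nonneg {A : Matrix ι ι ℝ} (hA : A.IsHermitian) :
    0 ≤ (NormedSpace.exp A).trace := by
  obtain ⟨U, a, hU, hU', rfl⟩ := exists_orthogonal_diagonalization hA
  rw [exp_orthogonal_conj hU, trace_orthogonal_conj hU']
  exact Finset.sum_nonneg fun i _ => (Real.exp_pos _).le

theorem sum_transpose_mulVec_sq {U : Matrix ι ι ℝ} (hU : U * Uᵀ = 1) (x : ι → ℝ) :
    ∑ i, (Uᵀ *ᵥ x) i ^ 2 = x ⬝ᵥ x := by
  have := dotProduct_orthogonal_conj U 1 x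
  simpa [hU] using this.symm

theorem dotProduct_exp_nonneg {A : Matrix ι ι ℝ} (hA : A.IsHermitian) (x : ι → ℝ) :
    0 ≤ x ⬝ᵥ NormedSpace.exp A *ᵥ x := by
  obtain ⟨U, a, hU, hU', rfl⟩ := exists_orthogonal_diagonalization hA
  rw [exp_orthogonal_conj hU, dotProduct_orthogonal_conj]
  exact Finset.sum_nonneg fun i _ => mul_nonneg (Real.exp_pos _).le (sq_nonneg _)

/-- The trace of `exp A` dominates the exponential of any Rayleigh quotient of `A`. -/
theorem exp_le_trace_exp {A : Matrix ι ι ℝ} (hA : A.IsHermitian) {x : ι → ℝ}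
    (hx : x ⬝ᵥ x = 1) {t : ℝ} (ht : t ≤ x ⬝ᵥ A *ᵥ x) :
    Real.exp t ≤ (NormedSpace.exp A).trace := by
  obtain ⟨U, a, hU, hU', rfl⟩ := exists_orthogonal_diagonalization hA
  rw [dotProduct_orthogonal_conj] at ht
  rw [exp_orthogonal_conj hU, trace_orthogonal_conj hU']
  have hw := sum_transpose_mulVec_sq hU x
  rw [hx] at hw
  set w := fun i => (Uᵀ *ᵥ x) i ^ 2 with hwdef
  have hw0 : ∀ i, 0 ≤ w i := fun i => sq_nonneg _
  have hw1 : ∀ i, w i ≤ 1 := fun i => by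
    rw [← hw]; exact Finset.single_le_sum (f := w) (fun j _ => hw0 j) (Finset.mem_univ i)
  -- Jensen's inequality through the tangent to `exp` at `t`, for the weights `w` of total mass one.
  calc Real.exp t ≤ Real.exp t * ∑ i, w i * (1 + (a i - t)) := by
        refine le_mul_of_one_le_right (Real.exp_pos _).le ?_
        have : ∑ i, w i * (1 + (a i - t)) = (1 - t) * ∑ i, w i + ∑ i, a i * w i := by
          rw [Finset.mul_sum, ← Finset.sum_add_distrib]
          exact Finset.sum_congr rfl fun i _ => by ring
        rw [this, hw]
        linarith
    _ = ∑ i, w i * (Real.exp t * (1 + (a i - t))) := by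
        rw [Finset.mul_sum]; exact Finset.sum_congr rfl fun i _ => by ring
    _ ≤ ∑ i, 1 * Real.exp (a i) := by
        refine Finset.sum_le_sum fun i _ => ?_
        have h1 : Real.exp t * (1 + (a i - t)) ≤ Real.exp (a i) := by
          have h2 := Real.add_one_le_exp (a i - t)
          calc _ ≤ Real.exp t * Real.exp (a i - t) := by gcongr; linarith
            _ = _ := by rw [← Real.exp_add]; congr 1; ring
        exact (mul_le_mul_of_nonneg_left h1 (hw0 i)).trans
          (mul_le_mul_of_nonneg_right (hw1 i) (Real.exp_pos _).le)
    _ = _ := by simp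

/-- Replacing `s x xᵀ` by the scalar `s |x|²` can only increase the moments. Telescoping both `N`-th
powers gives matching sums; on the matrix side the rank-one middle factor splits each term into a
product of two quadratic forms. Induction bounds the second, and Chebyshev's sum inequality merges
the product, both factors being increasing in `a i`. -/
theorem dotProduct_add_vecMulVec_pow_le {U : Matrix ι ι ℝ} (hU : U * Uᵀ = 1) (hU' : Uᵀ * U = 1)
    {a : ι → ℝ} (ha : ∀ i, 0 ≤ a i) {s : ℝ} (hs : 0 ≤ s) (x : ι → ℝ) (N : ℕ) :
    x ⬝ᵥ (U * diagonal a * Uᵀ + s • vecMulVec x x) ^ N *ᵥ x ≤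
      ∑ i, (a i + s * (x ⬝ᵥ x)) ^ N * (Uᵀ *ᵥ x) i ^ 2 := by
  have hr : 0 ≤ x ⬝ᵥ x := by
    rw [← sum_transpose_mulVec_sq hU]; exact Finset.sum_nonneg fun i _ => sq_nonneg _
  induction N using Nat.strong_induction_on with
  | _ N ih =>
  rw [pow_eq_pow_add_sum_range (U * diagonal a * Uᵀ) (_ + _), add_mulVec, dotProduct_add,
    add_sub_cancel_left, sum_mulVec, dotProduct_sum, pow_orthogonal_conj hU hU',
    dotProduct_orthogonal_conj]
  have e : ∀ i, (a i + s * (x ⬝ᵥ x)) ^ N * (Uᵀ *ᵥ x) i ^ 2 = a i ^ N * (Uᵀ *ᵥ x) i ^ 2 +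
      ∑ m ∈ Finset.range N, s * (x ⬝ᵥ x) *
        (a i ^ (N - 1 - m) * (a i + s * (x ⬝ᵥ x)) ^ m * (Uᵀ *ᵥ x) i ^ 2) := fun i => by
    rw [pow_eq_pow_add_sum_range (a i) (a i + _), add_sub_cancel_left, add_mul, Finset.sum_mul]
    congr 1
    exact Finset.sum_congr rfl fun m _ => by ring
  simp_rw [e, Finset.sum_add_distrib]
  rw [Finset.sum_comm]
  simp_rw [← Finset.mul_sum]
  rw [Finset.mul_sum]
  refine add_le_add_right (Finset.sum_le_sum fun m hm => ?_) _
  rw [Matrix.mul_smul, Matrix.smul_mul, smul_mulVec, dotProduct_smul, smul_eq_mul,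
    dotProduct_mul_vecMulVec_mul, mul_assoc s]
  refine mul_le_mul_of_nonneg_left ?_ hs
  rw [pow_orthogonal_conj hU hU', dotProduct_orthogonal_conj]
  have hnn : 0 ≤ ∑ i, a i ^ (N - 1 - m) * (Uᵀ *ᵥ x) i ^ 2 :=
    Finset.sum_nonneg fun i _ => mul_nonneg (pow_nonneg (ha i) _) (sq_nonneg _)
  refine (mul_le_mul_of_nonneg_left (ih m (Finset.mem_range.1 hm)) hnn).trans ?_
  rw [← sum_transpose_mulVec_sq hU x]
  refine sum_mul_sum_le_sum_mul_sum_of_monovary (fun i => sq_nonneg _) ?_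
  rw [sum_transpose_mulVec_sq hU x]
  intro i j hij
  have : a i ≤ a j := by
    by_contra! hlt
    refine absurd hij (not_lt.2 ?_)
    have := ha j
    beta_reduce
    gcongr
  have := ha i
  beta_reduce
  gcongr

theorem dotProduct_exp_hasSum {B : Matrix ι ι ℝ} (hB : B.IsHermitian) (x : ι → ℝ) :
    HasSum (fun N : ℕ => (N.factorial : ℝ)⁻¹ * (x ⬝ᵥ B ^ N *ᵥ x))
      (x ⬝ᵥ NormedSpace.exp B *ᵥ x) := by
  obtain ⟨V, b, hV, hV', rfl⟩ := exists_orthogonal_diagonalization hB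
  simp_rw [exp_orthogonal_conj hV, pow_orthogonal_conj hV hV', dotProduct_orthogonal_conj]
  exact hasSum_sum_exp_mul b _

theorem dotProduct_exp_add_smul_vecMulVec_le {A : Matrix ι ι ℝ} (hA : A.IsHermitian)
    {s : ℝ} (hs : 0 ≤ s) (x : ι → ℝ) :
    x ⬝ᵥ NormedSpace.exp (A + s • vecMulVec x x) *ᵥ x ≤
      Real.exp (s * (x ⬝ᵥ x)) * (x ⬝ᵥ NormedSpace.exp A *ᵥ x) := by
  obtain ⟨U, a, hU, hU', rfl⟩ := exists_orthogonal_diagonalization hA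
  -- The moment comparison needs a nonnegative spectrum; the shift by `c` multiplies both sides by
  -- `exp c` and cancels.
  obtain ⟨c, hc⟩ : ∃ c : ℝ, ∀ i, 0 ≤ a i + c := by
    obtain ⟨c, hc⟩ := (Set.finite_range fun i => -a i).bddAbove
    exact ⟨c, fun i => by have := hc ⟨i, rfl⟩; simp only at this; linarith⟩
  have hshift : U * diagonal (fun i => a i + c) * Uᵀ + s • vecMulVec x x =
      (U * diagonal a * Uᵀ + s • vecMulVec x x) + c • (1 : Matrix ι ι ℝ) := by
    have : diagonal (fun i => a i + c) = diagonal a + c • (1 : Matrix ι ι ℝ) := by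
      rw [smul_one_eq_diagonal, diagonal_add]
    rw [this, Matrix.mul_add, Matrix.add_mul, Matrix.mul_smul, Matrix.mul_one, Matrix.smul_mul, hU]
    abel
  have hexp : NormedSpace.exp (U * diagonal (fun i => a i + c) * Uᵀ + s • vecMulVec x x) =
      Real.exp c • NormedSpace.exp (U * diagonal a * Uᵀ + s • vecMulVec x x) := by
    rw [hshift, Matrix.exp_add_of_commute _ _ ((Commute.one_right _).smul_right c),
      smul_one_eq_diagonal, Matrix.exp_diagonal]
    have : NormedSpace.exp (fun _ : ι => c) = fun _ => Real.exp c := by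
      ext i; rw [Pi.coe_exp, Real.exp_eq_exp_ℝ]
    rw [this, ← smul_one_eq_diagonal, Matrix.mul_smul, Matrix.mul_one]
  have hL := dotProduct_exp_hasSum (hshift ▸ (hA.add (isHermitian_smul_vecMulVec s x)).add
    ((isHermitian_one).smul (IsSelfAdjoint.all c))) x
  have hR := hasSum_sum_exp_mul (fun i => a i + c + s * (x ⬝ᵥ x)) fun i => (Uᵀ *ᵥ x) i ^ 2
  have hle := hasSum_le (fun N => mul_le_mul_of_nonneg_left
    (dotProduct_add_vecMulVec_pow_le hU hU' hc hs x N) (by positivity)) hL hR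
  rw [hexp, smul_mulVec, dotProduct_smul, smul_eq_mul] at hle
  rw [exp_orthogonal_conj hU, dotProduct_orthogonal_conj]
  have e : ∑ i, Real.exp (a i + c + s * (x ⬝ᵥ x)) * (Uᵀ *ᵥ x) i ^ 2 = Real.exp c *
      (Real.exp (s * (x ⬝ᵥ x)) * ∑ i, Real.exp (a i) * (Uᵀ *ᵥ x) i ^ 2) := by
    rw [← mul_assoc, Finset.mul_sum]
    refine Finset.sum_congr rfl fun i _ => ?_
    rw [Real.exp_add, Real.exp_add]; ring
  rw [e] at hle
  exact le_of_mul_le_mul_left hle (Real.exp_pos c)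

theorem trace_exp_add_smul_vecMulVec_le {A : Matrix ι ι ℝ} (hA : A.IsHermitian)
    (θ : ℝ) (x : ι → ℝ) :
    (NormedSpace.exp (A + θ • vecMulVec x x)).trace ≤ (NormedSpace.exp A).trace +
      θ * Real.exp (θ * (x ⬝ᵥ x)) * (x ⬝ᵥ NormedSpace.exp A *ᵥ x) := by
  have hB := hA.add (isHermitian_smul_vecMulVec θ x)
  -- Klein's inequality based at the perturbed matrix leaves its exponential in the correction term;
  -- `key` trades it for `exp A`.
  have hK := trace_exp_add_trace_exp_mul_sub_le hB hA
  have e : A - (A + θ • vecMulVec x x) = (-θ) • vecMulVec x x := by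
    rw [neg_smul]; abel
  rw [e, Matrix.mul_smul, trace_smul, smul_eq_mul, mul_vecMulVec, trace_vecMulVec,
    dotProduct_comm] at hK
  have key : θ * (x ⬝ᵥ NormedSpace.exp (A + θ • vecMulVec x x) *ᵥ x) ≤
      θ * (Real.exp (θ * (x ⬝ᵥ x)) * (x ⬝ᵥ NormedSpace.exp A *ᵥ x)) := by
    rcases le_total 0 θ with hθ | hθ
    · exact mul_le_mul_of_nonneg_left (dotProduct_exp_add_smul_vecMulVec_le hA hθ x) hθ
    · refine mul_le_mul_of_nonpos_left ?_ hθ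
      -- For negative `θ`, view `A` as a positive perturbation of `A + θ x xᵀ`; the reversed bound
      -- is what a negative factor requires.
      have h := dotProduct_exp_add_smul_vecMulVec_le hB (neg_nonneg.2 hθ) x
      rw [neg_smul, add_neg_cancel_right] at h
      calc _ ≤ Real.exp (θ * (x ⬝ᵥ x)) * _ := mul_le_mul_of_nonneg_left h (Real.exp_pos _).le
        _ = _ := by
          rw [← mul_assoc, ← Real.exp_add, neg_mul, add_neg_cancel, Real.exp_zero, one_mul]
  linarith

theorem sum_trace_exp_add_smul_vecMulVec_le {κ : Type*} [Fintype κ] {A : Matrix ι ι ℝ}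
    (hA : A.IsHermitian) (θ : ℝ) {q : κ → ι → ℝ} (hq : ∑ j, vecMulVec (q j) (q j) = 1)
    {R : ℝ} (hR : ∀ j, q j ⬝ᵥ q j ≤ R) :
    ∑ j, (NormedSpace.exp (A + θ • vecMulVec (q j) (q j))).trace ≤
      (Fintype.card κ + θ * Real.exp (θ * R)) * (NormedSpace.exp A).trace := by
  have htr : ∑ j, q j ⬝ᵥ NormedSpace.exp A *ᵥ q j = (NormedSpace.exp A).trace := by
    have : (NormedSpace.exp A * ∑ j, vecMulVec (q j) (q j)).trace = (NormedSpace.exp A).trace := by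
      rw [hq, Matrix.mul_one]
    rw [← this, Finset.mul_sum, trace_sum]
    refine Finset.sum_congr rfl fun j _ => ?_
    rw [mul_vecMulVec, trace_vecMulVec, dotProduct_comm]
  calc _ ≤ ∑ j, ((NormedSpace.exp A).trace +
        θ * Real.exp (θ * R) * (q j ⬝ᵥ NormedSpace.exp A *ᵥ q j)) := by
        refine Finset.sum_le_sum fun j _ => (trace_exp_add_smul_vecMulVec_le hA θ (q j)).trans ?_
        have h0 := dotProduct_exp_nonneg hA (q j)
        have : θ * Real.exp (θ * (q j ⬝ᵥ q j)) ≤ θ * Real.exp (θ * R) := by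
          rcases le_total 0 θ with hθ | hθ
          · have := hR j
            gcongr
          · exact mul_le_mul_of_nonpos_left
              (Real.exp_le_exp.2 (mul_le_mul_of_nonpos_left (hR j) hθ)) hθ
        gcongr
    _ = _ := by
        rw [Finset.sum_add_distrib, ← Finset.mul_sum, htr, Finset.sum_const, Finset.card_univ,
          nsmul_eq_mul]
        ring

end TraceExp

/-! ### Hoeffding's comparison for sampling without replacement -/

section SamplingWithoutReplacement

variable {n m : ℕ}

theorem sum_embedding_succ (H : (Fin m ↪ Fin n) → Fin n → ℝ) :
    ∑ e : Fin (m + 1) ↪ Fin n, H (Equiv.embeddingFinSucc m (Fin n) e).1 (e 0) =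
      ∑ e : Fin m ↪ Fin n, ∑ j : {j // j ∉ Set.range e}, H e j := by
  rw [← Fintype.sum_sigma', ← (Equiv.embeddingFinSucc m (Fin n)).sum_comp]
  rfl

theorem sum_eq_sum_embedding_add (e : Fin m ↪ Fin n) (h : Fin n → ℝ) :
    ∑ j, h j = ∑ j : {j // j ∉ Set.range e}, h j + ∑ s, h (e s) := by
  rw [← Fintype.sum_subtype_add_sum_subtype (fun j => j ∈ Set.range e), add_comm]
  congr 1
  convert ((Equiv.ofInjective e e.injective).sum_comp fun j => h j).symm
  rfl

theorem card_notMem_range (e : Fin m ↪ Fin n) :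
    (Fintype.card {j // j ∉ Set.range e} : ℝ) = n - m := by
  have h := sum_eq_sum_embedding_add e fun _ => 1
  simp only [Finset.sum_const, Finset.card_univ, nsmul_eq_mul, mul_one, Fintype.card_fin] at h
  linarith

theorem card_embedding_succ :
    (Fintype.card (Fin (m + 1) ↪ Fin n) : ℝ) = (n - m) * Fintype.card (Fin m ↪ Fin n) := by
  have h := sum_embedding_succ (n := n) (m := m) fun _ _ => 1
  simp only [Finset.sum_const, Finset.card_univ, nsmul_eq_mul, mul_one] at h
  rw [h]
  simp_rw [card_notMem_range]
  rw [Finset.sum_const, Finset.card_univ, nsmul_eq_mul, mul_comm]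

variable {E : Type*} [AddCommGroup E] {P : AddSubgroup E} {f : E → ℝ} {X : Fin n → E}

/-- Convexity with `D = X (e t) - X (e s)` bounds the summand by the mean of two replacements, and
exchanging the positions `s` and `t` shows that both have the same total. -/
theorem sum_embedding_le_sum_replace (hf : ∀ S ∈ P, ∀ D ∈ P, 2 * f S ≤ f (S + D) + f (S - D))
    (hX : ∀ j, X j ∈ P) (s t : Fin m) :
    ∑ e : Fin m ↪ Fin n, f (∑ i, X (e i)) ≤
      ∑ e : Fin m ↪ Fin n, f (∑ i, X (e i) - X (e s) + X (e t)) := by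
  have hswap : ∑ e : Fin m ↪ Fin n, f (∑ i, X (e i) - X (e s) + X (e t)) =
      ∑ e : Fin m ↪ Fin n, f (∑ i, X (e i) - X (e t) + X (e s)) := by
    rw [← ((Equiv.swap s t).embeddingCongr (Equiv.refl (Fin n))).sum_comp]
    refine Finset.sum_congr rfl fun e _ => ?_
    have h : ∀ i, (Equiv.swap s t).embeddingCongr (Equiv.refl (Fin n)) e i =
        e (Equiv.swap s t i) := fun i => by simp [Equiv.embeddingCongr]
    simp_rw [h, Equiv.swap_apply_left, Equiv.swap_apply_right]
    rw [Equiv.sum_comp (Equiv.swap s t) fun i => X (e i)]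
  have h2 : 2 * ∑ e : Fin m ↪ Fin n, f (∑ i, X (e i)) ≤
      ∑ e : Fin m ↪ Fin n, f (∑ i, X (e i) - X (e s) + X (e t)) +
      ∑ e : Fin m ↪ Fin n, f (∑ i, X (e i) - X (e t) + X (e s)) := by
    rw [Finset.mul_sum, ← Finset.sum_add_distrib]
    refine Finset.sum_le_sum fun e _ => ?_
    have := hf _ (sum_mem fun i (_ : i ∈ Finset.univ) => hX (e i)) _
      (sub_mem (hX (e t)) (hX (e s)))
    rwa [← add_sub_assoc, add_sub_right_comm, ← sub_add] at this
  linarith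

/-- Hoeffding's comparison of one more draw without replacement with one more draw with
replacement, for a midpoint convex function of the sum. -/
theorem card_mul_sum_embedding_succ_le
    (hf : ∀ S ∈ P, ∀ D ∈ P, 2 * f S ≤ f (S + D) + f (S - D)) (hX : ∀ j, X j ∈ P) :
    n * ∑ e : Fin (m + 1) ↪ Fin n, f (∑ i, X (e i)) ≤
      (n - m) * ∑ e : Fin m ↪ Fin n, ∑ j, f (∑ i, X (e i) + X j) := by
  have htail : ∀ e : Fin (m + 1) ↪ Fin n, ∑ i, X (e i) =
      ∑ i, X ((Equiv.embeddingFinSucc m (Fin n) e).1 i) + X (e 0) := fun e => by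
    rw [Fin.sum_univ_succ, add_comm]; rfl
  set T := ∑ e : Fin (m + 1) ↪ Fin n, f (∑ i, X (e i)) with hT
  have hnew : ∑ e : Fin m ↪ Fin n, ∑ j : {j // j ∉ Set.range e}, f (∑ i, X (e i) + X j) = T := by
    rw [← sum_embedding_succ fun e j => f (∑ i, X (e i) + X j), hT]
    simp_rw [htail]
  -- Fresh indices `j` contribute exactly `T`. A repeated index `e s` arises by overwriting the
  -- newest draw with a copy, which leaves that draw free: hence the factor `n - m`. Altogether `(n
  -- - m) T + m T = n T`.
  have hrep : ∀ s : Fin m, T ≤ (n - m) * ∑ e : Fin m ↪ Fin n, f (∑ i, X (e i) + X (e s)) :=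
    fun s => by
    refine (sum_embedding_le_sum_replace hf hX 0 s.succ).trans (le_of_eq ?_)
    have h := sum_embedding_succ (n := n) (m := m) fun e _ => f (∑ i, X (e i) + X (e s))
    simp only [Finset.sum_const, Finset.card_univ, nsmul_eq_mul, card_notMem_range,
      ← Finset.mul_sum] at h
    rw [← h]
    refine Finset.sum_congr rfl fun e _ => ?_
    rw [htail, add_sub_cancel_right]
    rfl
  rw [Finset.sum_congr rfl fun e _ => sum_eq_sum_embedding_add e fun j => f (∑ i, X (e i) + X j),
    Finset.sum_add_distrib, hnew, Finset.sum_comm, mul_add]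
  have := Finset.sum_le_sum fun s (_ : s ∈ Finset.univ) => hrep s
  rw [Finset.sum_const, Finset.card_univ, nsmul_eq_mul, Fintype.card_fin,
    ← Finset.mul_sum] at this
  linarith

theorem sum_embedding_le (hf : ∀ S ∈ P, ∀ D ∈ P, 2 * f S ≤ f (S + D) + f (S - D))
    (hX : ∀ j, X j ∈ P) {c : ℝ} (hc : 0 ≤ c)
    (hstep : ∀ S ∈ P, ∑ j, f (S + X j) ≤ n * c * f S) (hn : 0 < n) (m : ℕ) :
    ∑ e : Fin m ↪ Fin n, f (∑ i, X (e i)) ≤ Fintype.card (Fin m ↪ Fin n) * c ^ m * f 0 := by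
  induction m with
  | zero => simp
  | succ m ih =>
    rcases Nat.lt_or_ge n (m + 1) with hnm | hnm
    · have : IsEmpty (Fin (m + 1) ↪ Fin n) := by
        rw [← Fintype.card_eq_zero_iff, Fintype.card_embedding_eq]
        simpa using Nat.descFactorial_eq_zero_iff_lt.2 hnm
      simp
    have hn' : (0 : ℝ) < n := by exact_mod_cast hn
    have hnm' : (0 : ℝ) ≤ n - m := by
      have : ((m + 1 : ℕ) : ℝ) ≤ n := by exact_mod_cast hnm
      push_cast at this; linarith
    refine le_of_mul_le_mul_left ((card_mul_sum_embedding_succ_le hf hX).trans ?_) hn'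
    calc _ ≤ (n - m) * ∑ e : Fin m ↪ Fin n, n * c * f (∑ i, X (e i)) :=
          mul_le_mul_of_nonneg_left (Finset.sum_le_sum fun e _ =>
            hstep _ (sum_mem fun i _ => hX (e i))) hnm'
      _ = (n - m) * (n * c) * ∑ e : Fin m ↪ Fin n, f (∑ i, X (e i)) := by
          rw [← Finset.mul_sum]; ring
      _ ≤ (n - m) * (n * c) * (Fintype.card (Fin m ↪ Fin n) * c ^ m * f 0) := by gcongr
      _ = _ := by rw [card_embedding_succ, pow_succ]; ring

/-! ### Matrix Chernoff bound without replacement -/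

open Matrix

variable {ι : Type*} [Fintype ι] [DecidableEq ι]

/-- An Ahlswede–Winter bound on the matrix moment generating function of a sum of rank-one
matrices drawn without replacement. -/
theorem sum_trace_exp_embedding_le {q : Fin n → ι → ℝ} (hq : ∑ j, vecMulVec (q j) (q j) = 1)
    {R : ℝ} (hR : ∀ j, q j ⬝ᵥ q j ≤ R) (hn : 0 < n) (θ : ℝ) (m : ℕ) :
    ∑ e : Fin m ↪ Fin n, (NormedSpace.exp (∑ i, θ • vecMulVec (q (e i)) (q (e i)))).trace ≤
      Fintype.card (Fin m ↪ Fin n) * Real.exp (m * (θ * Real.exp (θ * R) / n)) *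
        Fintype.card ι := by
  have hn' : (0 : ℝ) < n := by exact_mod_cast hn
  let P : AddSubgroup (Matrix ι ι ℝ) :=
    { carrier := {A | A.IsHermitian}
      zero_mem' := isHermitian_zero
      add_mem' := fun ha hb => ha.add hb
      neg_mem' := fun ha => ha.neg }
  have h := sum_embedding_le (P := P) (f := fun A => (NormedSpace.exp A).trace)
    (X := fun j => θ • vecMulVec (q j) (q j)) (fun S hS D hD => two_mul_trace_exp_le hS hD)
    (fun j => isHermitian_smul_vecMulVec θ (q j))
    (Real.exp_pos (θ * Real.exp (θ * R) / n)).le (fun S hS => by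
      refine (sum_trace_exp_add_smul_vecMulVec_le hS θ hq hR).trans
        (mul_le_mul_of_nonneg_right ?_ (trace_exp_nonneg hS))
      rw [Fintype.card_fin]
      have := Real.add_one_le_exp (θ * Real.exp (θ * R) / n)
      calc _ = (n : ℝ) * (θ * Real.exp (θ * R) / n + 1) := by field_simp; ring
        _ ≤ _ := by gcongr) hn m
  rw [NormedSpace.exp_zero, trace_one, ← Real.exp_nat_mul] at h
  exact h

/-- Chernoff bound: the number of injective samples whose Gram matrix, scaled by `θ`, has a
Rayleigh quotient of at least `t`. -/
theorem card_rayleigh_le {q : Fin n → ι → ℝ} (hq : ∑ j, vecMulVec (q j) (q j) = 1)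
    {R : ℝ} (hR : ∀ j, q j ⬝ᵥ q j ≤ R) (hn : 0 < n) (θ t : ℝ) (m : ℕ)
    (B : Finset (Fin m ↪ Fin n))
    (hB : ∀ e ∈ B, ∃ z : ι → ℝ, z ⬝ᵥ z = 1 ∧ t ≤ θ * ∑ i, (q (e i) ⬝ᵥ z) ^ 2) :
    (B.card : ℝ) ≤ Fintype.card (Fin m ↪ Fin n) *
      (Fintype.card ι * Real.exp (m * (θ * Real.exp (θ * R) / n) - t)) := by
  have hherm : ∀ e : Fin m ↪ Fin n,
      (∑ i, θ • vecMulVec (q (e i)) (q (e i))).IsHermitian := fun e =>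
    isSelfAdjoint_sum _ fun i _ => isHermitian_smul_vecMulVec θ (q (e i))
  have h1 : B.card * Real.exp t ≤
      ∑ e : Fin m ↪ Fin n, (NormedSpace.exp (∑ i, θ • vecMulVec (q (e i)) (q (e i)))).trace := by
    rw [← nsmul_eq_mul, ← Finset.sum_const]
    refine (Finset.sum_le_sum fun e he => ?_).trans
      (Finset.sum_le_univ_sum_of_nonneg fun e => trace_exp_nonneg (hherm e))
    obtain ⟨z, hz, ht⟩ := hB e he
    refine exp_le_trace_exp (hherm e) hz (ht.trans (le_of_eq ?_))
    rw [sum_mulVec, dotProduct_sum, Finset.mul_sum]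
    refine Finset.sum_congr rfl fun i _ => ?_
    rw [smul_mulVec, vecMulVec_mulVec, op_smul_eq_smul, dotProduct_smul, dotProduct_smul,
      smul_eq_mul, smul_eq_mul, dotProduct_comm z, sq]
  have h2 := h1.trans (sum_trace_exp_embedding_le hq hR hn θ m)
  rw [Real.exp_sub]
  calc (B.card : ℝ) = B.card * Real.exp t / Real.exp t := by
        rw [mul_div_cancel_right₀ _ (Real.exp_pos t).ne']
    _ ≤ _ := div_le_div_of_nonneg_right h2 (Real.exp_pos t).le
    _ = _ := by ring

end SamplingWithoutReplacement

/-! ### Sampling a subspace of low coherence -/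

section SubspaceSampling

open Matrix

/-- The chosen coordinates of every vector of `V`, rescaled, carry its energy up to the factors
`a` and `b`. -/
def IsSamplingFrame {ρ n : ℕ} (V : Submodule ℝ (Fin n → ℝ)) (a b : ℝ) (ω : Fin ρ → Fin n) :
    Prop :=
  ∀ x ∈ V, a * ∑ j, x j ^ 2 ≤ (n / ρ : ℝ) * ∑ i, x (ω i) ^ 2 ∧
    (n / ρ : ℝ) * ∑ i, x (ω i) ^ 2 ≤ b * ∑ j, x j ^ 2

theorem uniformOn_injective_apply_le {ρ n : ℕ} (G : (Fin ρ → Fin n) → Prop) {c : ℝ}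
    (B : Finset (Fin ρ ↪ Fin n)) (hB : ∀ e, e ∈ B ↔ ¬ G e)
    (hc : (B.card : ℝ) ≤ Fintype.card (Fin ρ ↪ Fin n) * c) :
    uniformOn {f : Fin ρ → Fin n | Function.Injective f} {f | ¬ G f} ≤ ENNReal.ofReal c := by
  have hinj : Function.Injective (fun e : Fin ρ ↪ Fin n => (e : Fin ρ → Fin n)) :=
    DFunLike.coe_injective
  have h1 : {f : Fin ρ → Fin n | Function.Injective f} =
      (fun e : Fin ρ ↪ Fin n => (e : Fin ρ → Fin n)) '' (Finset.univ : Finset (Fin ρ ↪ Fin n)) := by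
    ext f
    constructor
    · intro hf
      exact ⟨⟨f, hf⟩, by simp, rfl⟩
    · rintro ⟨e, -, rfl⟩
      exact e.injective
  have h2 : {f : Fin ρ → Fin n | Function.Injective f} ∩ {f | ¬ G f} =
      (fun e : Fin ρ ↪ Fin n => (e : Fin ρ → Fin n)) '' (B : Set (Fin ρ ↪ Fin n)) := by
    ext f
    constructor
    · rintro ⟨hf, hG⟩
      exact ⟨⟨f, hf⟩, (hB _).2 hG, rfl⟩
    · rintro ⟨e, he, rfl⟩
      exact ⟨e.injective, (hB e).1 he⟩
  have hs : MeasurableSet {f : Fin ρ → Fin n | Function.Injective f} :=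
    (Set.toFinite _).measurableSet
  rw [uniformOn, cond_apply hs, h2, h1, Measure.count_apply (Set.toFinite _).measurableSet,
    Measure.count_apply (Set.toFinite _).measurableSet, hinj.encard_image, hinj.encard_image,
    Set.encard_coe_eq_coe_finsetCard, Set.encard_coe_eq_coe_finsetCard, Finset.card_univ]
  rcases Nat.eq_zero_or_pos (Fintype.card (Fin ρ ↪ Fin n)) with h0 | h0
  · have : B.card = 0 := by
      have := Finset.card_le_univ B
      omega
    simp [this]
  · have h0' : (0 : ℝ) < Fintype.card (Fin ρ ↪ Fin n) := by exact_mod_cast h0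
    have hle : ((B.card : ℕ) : ENNReal) ≤
        (Fintype.card (Fin ρ ↪ Fin n) : ENNReal) * ENNReal.ofReal c := by
      rw [← ENNReal.ofReal_natCast, ← ENNReal.ofReal_natCast, ← ENNReal.ofReal_mul h0'.le]
      exact ENNReal.ofReal_le_ofReal hc
    rw [mul_comm, ← div_eq_mul_inv]
    refine ENNReal.div_le_of_le_mul ?_
    rw [mul_comm]
    simpa using hle

/-- With `θ = τ / R` the Chernoff exponent is `-(ρ / (n * R)) * τ * (a - exp τ)`, so a rate of `δ ^
2 / 27` cancels the constant in the sample size. The sign of `τ` selects the tail. -/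
theorem card_rayleigh_le_of_sample_size {n ρ k : ℕ} {q : Fin n → Fin k → ℝ}
    (hq : ∑ j, vecMulVec (q j) (q j) = 1) {R : ℝ} (hR : ∀ j, q j ⬝ᵥ q j ≤ R) (hR0 : 0 < R)
    (hn : 0 < n) (hk : 0 < k) {δ ε : ℝ} (hδ : 0 < δ) (hε : 0 < ε)
    (hρ : 27 / δ ^ 2 * (n * R) * Real.log (4 * k / ε) ≤ ρ) {τ a : ℝ}
    (hτ : δ ^ 2 / 27 ≤ τ * (a - Real.exp τ)) (B : Finset (Fin ρ ↪ Fin n))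
    (hB : ∀ e ∈ B, ∃ z : Fin k → ℝ, z ⬝ᵥ z = 1 ∧ τ * (a * (ρ / n)) ≤
      τ * ∑ i, (q (e i) ⬝ᵥ z) ^ 2) :
    (B.card : ℝ) ≤ Fintype.card (Fin ρ ↪ Fin n) * (ε / 4) := by
  have hn' : (0 : ℝ) < n := by exact_mod_cast hn
  have hk' : (0 : ℝ) < k := by exact_mod_cast hk
  refine (card_rayleigh_le hq hR hn (τ / R) (τ / R * (a * (ρ / n))) ρ B
    fun e he => ?_).trans ?_
  · obtain ⟨z, hz, h⟩ := hB e he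
    refine ⟨z, hz, ?_⟩
    rw [div_mul_eq_mul_div, div_mul_eq_mul_div]
    exact div_le_div_of_nonneg_right h hR0.le
  refine mul_le_mul_of_nonneg_left ?_ (Nat.cast_nonneg _)
  have hexp : ρ * (τ / R * Real.exp (τ / R * R) / n) - τ / R * (a * (ρ / n)) ≤
      -Real.log (4 * k / ε) := by
    have e1 : ρ * (τ / R * Real.exp (τ / R * R) / n) - τ / R * (a * (ρ / n)) =
        -(ρ / (n * R) * (τ * (a - Real.exp τ))) := by
      rw [div_mul_cancel₀ _ hR0.ne']
      field_simp
      ring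
    rw [e1, neg_le_neg_iff]
    have e2 : 27 / δ ^ 2 * Real.log (4 * k / ε) ≤ ρ / (n * R) := by
      rw [le_div_iff₀ (by positivity)]
      linarith
    calc Real.log (4 * k / ε) = 27 / δ ^ 2 * Real.log (4 * k / ε) * (δ ^ 2 / 27) := by
          field_simp
      _ ≤ ρ / (n * R) * (δ ^ 2 / 27) := by gcongr
      _ ≤ _ := by gcongr
  rw [Fintype.card_fin]
  calc _ ≤ k * Real.exp (-Real.log (4 * k / ε)) := by gcongr
    _ = ε / 4 := by
      rw [Real.exp_neg, Real.exp_log (by positivity)]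
      field_simp

/-- To leading order the rate is `0.19 * (0.414 - 0.19) * δ ^ 2`, about `0.0426 * δ ^ 2`; the margin
over `1 / 27` absorbs the higher-order terms for `δ < 1`. -/
theorem upper_tail_rate {δ : ℝ} (hδ : 0 < δ) (hδ1 : δ < 1) :
    δ ^ 2 / 27 ≤ 0.19 * δ * (1 + 0.414 * δ - Real.exp (0.19 * δ)) := by
  have h := Real.exp_bound' (x := 0.19 * δ) (by positivity) (by linarith) (n := 3) (by norm_num)
  norm_num [Finset.sum_range_succ, Nat.factorial] at h
  nlinarith [mul_pos hδ hδ, mul_pos (mul_pos hδ hδ) (sub_pos.2 hδ1),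
    mul_pos (mul_pos hδ hδ) (mul_pos hδ (sub_pos.2 hδ1)), mul_le_mul_of_nonneg_left h hδ.le]

theorem lower_tail_rate {δ : ℝ} (hδ : 0 < δ) :
    δ ^ 2 / 27 ≤ -(δ / 4) * (1 - δ / 2 - Real.exp (-(δ / 4))) := by
  have h := Real.add_one_le_exp (-(δ / 4))
  nlinarith [mul_le_mul_of_nonneg_left h hδ.le]

theorem mem_colSpan_iff {n k : ℕ} {A : Matrix (Fin n) (Fin k) ℝ} {x : Fin n → ℝ} :
    x ∈ colSpan A ↔ ∃ z, A *ᵥ z = x := by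
  rw [colSpan, ← Matrix.range_mulVecLin]
  rfl

theorem sum_mulVec_sq {n k : ℕ} {A : Matrix (Fin n) (Fin k) ℝ} (hA : Aᵀ * A = 1)
    (z : Fin k → ℝ) : ∑ j, (A *ᵥ z) j ^ 2 = z ⬝ᵥ z := by
  calc ∑ j, (A *ᵥ z) j ^ 2 = (A *ᵥ z) ⬝ᵥ (A *ᵥ z) := by simp [dotProduct, sq]
    _ = _ := by
      rw [dotProduct_mulVec, ← mulVec_transpose, Matrix.mulVec_mulVec, hA, one_mulVec]

theorem sum_vecMulVec_row {n k : ℕ} {A : Matrix (Fin n) (Fin k) ℝ} (hA : Aᵀ * A = 1) :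
    ∑ j, vecMulVec (A j) (A j) = 1 := by
  rw [← hA]
  ext i l
  simp [Matrix.sum_apply, vecMulVec_apply, Matrix.mul_apply]

theorem row_dotProduct_self_le {n k : ℕ} (A : Matrix (Fin n) (Fin k) ℝ) (j : Fin n) :
    A j ⬝ᵥ A j ≤ cumulativeCoherence A ^ 2 / n := by
  have hn : (0 : ℝ) < n := by exact_mod_cast j.pos
  have h : √(n : ℝ) * ‖WithLp.toLp 2 (A.transpose.mulVec (Pi.single j 1))‖ ≤
      cumulativeCoherence A :=
    le_ciSup (f := fun i : Fin n => √(n : ℝ) *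
      ‖WithLp.toLp 2 (A.transpose.mulVec (Pi.single i 1))‖) (Set.finite_range _).bddAbove j
  have h2 := pow_le_pow_left₀ (by positivity) h 2
  rw [mul_pow, Real.sq_sqrt hn.le, EuclideanSpace.real_norm_sq_eq] at h2
  rw [le_div_iff₀ hn, mul_comm]
  refine le_trans (le_of_eq ?_) h2
  congr 1
  simp [dotProduct, sq]

/-- A vector violating a scale-invariant inequality between the sampled and the full energy
may be taken to be a unit vector. -/
theorem exists_unit_of_energy_lt {n k ρ : ℕ} {q : Fin n → Fin k → ℝ} {ω : Fin ρ → Fin n}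
    {τ a : ℝ} {z : Fin k → ℝ}
    (h : τ * (a * (ρ / n) * (z ⬝ᵥ z)) < τ * ∑ i, (q (ω i) ⬝ᵥ z) ^ 2) :
    ∃ z : Fin k → ℝ, z ⬝ᵥ z = 1 ∧ τ * (a * (ρ / n)) ≤ τ * ∑ i, (q (ω i) ⬝ᵥ z) ^ 2 := by
  have hz : z ≠ 0 := by
    rintro rfl
    simp at h
  have hpos : 0 < z ⬝ᵥ z := by
    have h0 : 0 ≤ z ⬝ᵥ z := Finset.sum_nonneg fun i _ => mul_self_nonneg _
    exact lt_of_le_of_ne h0 fun h => hz (dotProduct_self_eq_zero.1 h.symm)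
  have hs : (√(z ⬝ᵥ z))⁻¹ ^ 2 = (z ⬝ᵥ z)⁻¹ := by rw [inv_pow, Real.sq_sqrt hpos.le]
  refine ⟨(√(z ⬝ᵥ z))⁻¹ • z, ?_, ?_⟩
  · rw [dotProduct_smul, smul_dotProduct, smul_eq_mul, smul_eq_mul, ← mul_assoc, ← sq, hs,
      inv_mul_cancel₀ hpos.ne']
  · simp_rw [dotProduct_smul, smul_eq_mul, mul_pow, hs]
    rw [← Finset.mul_sum]
    refine le_of_mul_le_mul_right ?_ hpos
    calc _ = τ * (a * (ρ / n) * (z ⬝ᵥ z)) := by ring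
      _ ≤ τ * ∑ i, (q (ω i) ⬝ᵥ z) ^ 2 := h.le
      _ = _ := by field_simp

theorem uniformOn_not_isSamplingFrame_le {n k ρ : ℕ} {A : Matrix (Fin n) (Fin k) ℝ}
    (hA : Aᵀ * A = 1) {δ ε : ℝ} (hδ : 0 < δ) (hδ1 : δ < 1) (hε : 0 < ε) (hε1 : ε < 1)
    (hρ : 27 / δ ^ 2 * cumulativeCoherence A ^ 2 * Real.log (4 * k / ε) ≤ ρ) :
    uniformOn {f : Fin ρ → Fin n | Function.Injective f}
      {ω | ¬ IsSamplingFrame (colSpan A) (1 - δ / 2) (1 + 0.414 * δ) ω} ≤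
        ENNReal.ofReal (ε / 2) := by
  classical
  -- For `k = 0` the logarithm is `log 0 = 0` and `ρ` may vanish, but the span is trivial.
  rcases Nat.eq_zero_or_pos k with rfl | hk
  · have : {ω : Fin ρ → Fin n |
        ¬ IsSamplingFrame (colSpan A) (1 - δ / 2) (1 + 0.414 * δ) ω} = ∅ := by
      refine Set.eq_empty_of_forall_notMem fun ω hω => hω fun x hx => ?_
      obtain ⟨z, rfl⟩ := mem_colSpan_iff.1 hx
      simp [mulVec_eq_sum]
    rw [this, measure_empty]
    exact zero_le
  have hk' : (1 : ℝ) ≤ k := by exact_mod_cast hk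
  set R := cumulativeCoherence A ^ 2 / n with hRdef
  have hR : ∀ j, A j ⬝ᵥ A j ≤ R := row_dotProduct_self_le A
  -- Taking traces in `∑ q qᵀ = 1` gives `k = ∑ |q j|²`; this forces `n` and `R` to be positive.
  have hkR : (k : ℝ) ≤ n * R := by
    have h1 := congrArg Matrix.trace (sum_vecMulVec_row hA)
    rw [trace_sum, trace_one, Fintype.card_fin] at h1
    simp_rw [trace_vecMulVec] at h1
    rw [← h1]
    simpa using Finset.sum_le_sum fun j (_ : j ∈ Finset.univ) => hR j
  have hn : 0 < n := by
    rcases Nat.eq_zero_or_pos n with rfl | h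
    · simp at hkR; omega
    · exact h
  have hn' : (0 : ℝ) < n := by exact_mod_cast hn
  have hR0 : 0 < R := by
    have : 0 < n * R := by linarith
    exact (mul_pos_iff_of_pos_left hn').1 this
  have hnR : n * R = cumulativeCoherence A ^ 2 := by rw [hRdef]; field_simp
  rw [← hnR] at hρ
  have hlog : 0 < Real.log (4 * k / ε) := by
    refine Real.log_pos ?_
    rw [lt_div_iff₀ hε]
    linarith
  have hρ0 : (0 : ℝ) < ρ := lt_of_lt_of_le (by positivity) hρ
  let lo : Finset (Fin ρ ↪ Fin n) := {e | ∃ z : Fin k → ℝ, z ⬝ᵥ z = 1 ∧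
    -(δ / 4) * ((1 - δ / 2) * (ρ / n)) ≤ -(δ / 4) * ∑ i, (A (e i) ⬝ᵥ z) ^ 2}
  let hi : Finset (Fin ρ ↪ Fin n) := {e | ∃ z : Fin k → ℝ, z ⬝ᵥ z = 1 ∧
    0.19 * δ * ((1 + 0.414 * δ) * (ρ / n)) ≤ 0.19 * δ * ∑ i, (A (e i) ⬝ᵥ z) ^ 2}
  have hlo := card_rayleigh_le_of_sample_size (sum_vecMulVec_row hA) hR hR0 hn hk hδ hε hρ
    (lower_tail_rate hδ) lo fun e he => (Finset.mem_filter.1 he).2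
  have hhi := card_rayleigh_le_of_sample_size (sum_vecMulVec_row hA) hR hR0 hn hk hδ hε hρ
    (upper_tail_rate hδ hδ1) hi fun e he => (Finset.mem_filter.1 he).2
  refine uniformOn_injective_apply_le _
    {e : Fin ρ ↪ Fin n | ¬ IsSamplingFrame (colSpan A) (1 - δ / 2) (1 + 0.414 * δ) e}
    (fun e => by simp) ?_
  refine le_trans (b := ((lo ∪ hi).card : ℝ)) ?_ ?_
  · refine Nat.cast_le.2 (Finset.card_le_card fun e he => ?_)
    have he := (Finset.mem_filter.1 he).2
    unfold IsSamplingFrame at he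
    push Not at he
    obtain ⟨x, hx, hbad⟩ := he
    obtain ⟨z, rfl⟩ := mem_colSpan_iff.1 hx
    rw [sum_mulVec_sq hA] at hbad
    change _ → _ < (n / ρ : ℝ) * ∑ i, (A (e i) ⬝ᵥ z) ^ 2 at hbad
    have hnρ : (ρ / n : ℝ) * (n / ρ * ∑ i, (A (e i) ⬝ᵥ z) ^ 2) = ∑ i, (A (e i) ⬝ᵥ z) ^ 2 := by
      field_simp
    have hρn : (0 : ℝ) < ρ / n := by positivity
    rw [Finset.mem_union]
    by_cases h : (1 - δ / 2) * (z ⬝ᵥ z) ≤ n / ρ * ∑ i, (A (e i) ⬝ᵥ z) ^ 2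
    · right
      refine Finset.mem_filter.2 ⟨Finset.mem_univ _,
        exists_unit_of_energy_lt (q := A) (ω := e) (z := z) ?_⟩
      have := mul_lt_mul_of_pos_left (hbad h) hρn
      rw [hnρ] at this
      refine mul_lt_mul_of_pos_left ?_ (by positivity)
      linarith
    · left
      refine Finset.mem_filter.2 ⟨Finset.mem_univ _,
        exists_unit_of_energy_lt (q := A) (ω := e) (z := z) ?_⟩
      have := mul_lt_mul_of_pos_left (not_le.1 h) hρn
      rw [hnρ] at this
      refine mul_lt_mul_of_neg_left ?_ (by linarith)
      linarith
  · have : ((lo ∪ hi).card : ℝ) ≤ lo.card + hi.card := by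
      exact_mod_cast Finset.card_union_le lo hi
    linarith

/-! ### From the two subspaces to matrices -/

theorem firstCols_transpose_mul_self {n k : ℕ} {Q : Matrix (Fin n) (Fin n) ℝ}
    (hQ : Q ∈ Matrix.orthogonalGroup (Fin n) ℝ) (hk : k ≤ n) :
    (firstCols Q k hk)ᵀ * firstCols Q k hk = 1 := by
  have h : Qᵀ * Q = 1 := (Matrix.mem_orthogonalGroup_iff' (Fin n) ℝ).1 hQ
  ext i j
  have := congrFun (congrFun h (Fin.castLE hk i)) (Fin.castLE hk j)
  rw [Matrix.mul_apply] at this ⊢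
  simpa [firstCols, Matrix.one_apply] using this

theorem frobenius_norm_sq {m n : Type*} [Fintype m] [Fintype n] (Y : Matrix m n ℝ) :
    ‖Y‖ ^ 2 = ∑ i, ∑ j, Y i j ^ 2 := by
  rw [frobenius_norm_def, ← Real.sqrt_eq_rpow, Real.sq_sqrt (by positivity)]
  simp

theorem rowSampling_mul_mul_colSampling_apply {p n ρr ρc : ℕ} (ωr : Fin ρr → Fin p)
    (ωc : Fin ρc → Fin n) (Y : Matrix (Fin p) (Fin n) ℝ) (s : Fin ρr) (t : Fin ρc) :
    (rowSampling ωr * Y * colSampling ωc) s t = Y (ωr s) (ωc t) := by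
  simp [Matrix.mul_apply, rowSampling, colSampling]

/-- Sampling rows and columns with frames for the two subspaces samples the matrices of the
tensor product. -/
theorem IsSamplingFrame.frobenius_bounds {p n ρr ρc : ℕ} {V : Submodule ℝ (Fin p → ℝ)}
    {V' : Submodule ℝ (Fin n → ℝ)} {a b : ℝ} (ha : 0 ≤ a) (hb : 0 ≤ b)
    {ωr : Fin ρr → Fin p} {ωc : Fin ρc → Fin n}
    (hr : IsSamplingFrame V a b ωr) (hc : IsSamplingFrame V' a b ωc)
    {Y : Matrix (Fin p) (Fin n) ℝ} (hcol : ∀ j, Y.col j ∈ V) (hrow : ∀ i, Y.row i ∈ V') :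
    a ^ 2 * ‖Y‖ ^ 2 ≤
        (n * p : ℝ) / (ρr * ρc) * ‖rowSampling ωr * Y * colSampling ωc‖ ^ 2 ∧
      (n * p : ℝ) / (ρr * ρc) * ‖rowSampling ωr * Y * colSampling ωc‖ ^ 2 ≤
        b ^ 2 * ‖Y‖ ^ 2 := by
  simp_rw [frobenius_norm_sq, rowSampling_mul_mul_colSampling_apply]
  have e1 : (n * p : ℝ) / (ρr * ρc) * ∑ s, ∑ t, Y (ωr s) (ωc t) ^ 2 =
      n / ρc * ∑ t, p / ρr * ∑ s, Y (ωr s) (ωc t) ^ 2 := by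
    rw [Finset.sum_comm, ← Finset.mul_sum, ← mul_assoc]
    congr 1
    rw [div_mul_div_comm, mul_comm (ρr : ℝ)]
  have e2 : ∀ c : ℝ, n / ρc * ∑ t, c * ∑ i, Y i (ωc t) ^ 2 =
      c * ∑ i, n / ρc * ∑ t, Y i (ωc t) ^ 2 := fun c => by
    rw [← Finset.mul_sum, ← Finset.mul_sum, Finset.sum_comm]
    ring
  have e3 : ∀ c : ℝ, c ^ 2 * ∑ i, ∑ j, Y i j ^ 2 = c * ∑ i, c * ∑ j, Y i j ^ 2 := fun c => by
    rw [← Finset.mul_sum]; ring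
  rw [e1]
  constructor
  · rw [e3]
    refine le_trans ?_ (mul_le_mul_of_nonneg_left
      (Finset.sum_le_sum fun t _ => (hr _ (hcol (ωc t))).1) (by positivity))
    simp only [Matrix.col_apply]
    rw [e2]
    exact mul_le_mul_of_nonneg_left (Finset.sum_le_sum fun i _ => (hc _ (hrow i)).1) ha
  · rw [e3]
    refine (mul_le_mul_of_nonneg_left
      (Finset.sum_le_sum fun t _ => (hr _ (hcol (ωc t))).2) (by positivity)).trans ?_
    simp only [Matrix.col_apply]
    rw [e2]
    exact mul_le_mul_of_nonneg_left (Finset.sum_le_sum fun i _ => (hc _ (hrow i)).2) hb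

theorem measureReal_not_isSamplingFrame_le {n k ρ : ℕ} {A : Matrix (Fin n) (Fin k) ℝ}
    (hA : Aᵀ * A = 1) {S : Type*} [MeasurableSpace S] {μ : Measure S} {ω : S → Fin ρ → Fin n}
    (hω : IsUniformWithoutReplacement μ ω)
    {δ ε : ℝ} (hδ : 0 < δ) (hδ1 : δ < 1) (hε : 0 < ε) (hε1 : ε < 1)
    (hρ : 27 / δ ^ 2 * cumulativeCoherence A ^ 2 * Real.log (4 * k / ε) ≤ ρ) :
    μ.real {s | ¬ IsSamplingFrame (colSpan A) (1 - δ / 2) (1 + 0.414 * δ) (ω s)} ≤ ε / 2 := by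
  refine ENNReal.toReal_le_of_le_ofReal (by positivity) ?_
  refine (HasLaw.measure_eq hω
    (p := fun ω => ¬ IsSamplingFrame (colSpan A) (1 - δ / 2) (1 + 0.414 * δ) ω)
    (Set.toFinite _).measurableSet).le.trans ?_
  exact uniformOn_not_isSamplingFrame_le hA hδ hδ1 hε hε1 hρ

end SubspaceSampling

theorem theorem1 {p n kr kc ρr ρc : ℕ}
    (Gr : WeightedGraph (Fin p)) (Gc : WeightedGraph (Fin n))
    (Lr P : Matrix (Fin p) (Fin p) ℝ) (lamr : Fin p → ℝ)
    (Lc Q : Matrix (Fin n) (Fin n) ℝ) (lamc : Fin n → ℝ)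
    (hLr : Gr.IsLaplacian Lr) (hLc : Gc.IsLaplacian Lc)
    (hP : IsSortedEigendecomposition Lr P lamr) (hQ : IsSortedEigendecomposition Lc Q lamc)
    (hkr : kr ≤ p) (hkc : kc ≤ n)
    {S : Type*} [MeasurableSpace S] (μ : Measure S) [IsProbabilityMeasure μ]
    (ωr : S → Fin ρr → Fin p) (ωc : S → Fin ρc → Fin n)
    (hωr : IsUniformWithoutReplacement μ ωr) (hωc : IsUniformWithoutReplacement μ ωc)
    (δ ε : ℝ) (hδ : δ ∈ Set.Ioo (0 : ℝ) 1) (hε : ε ∈ Set.Ioo (0 : ℝ) 1)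
    (hρc : (ρc : ℝ) ≥ 27 / δ ^ 2 * cumulativeCoherence (firstCols Q kc hkc) ^ 2 *
      Real.log (4 * kc / ε))
    (hρr : (ρr : ℝ) ≥ 27 / δ ^ 2 * cumulativeCoherence (firstCols P kr hkr) ^ 2 *
      Real.log (4 * kr / ε)) :
    1 - ε ≤ μ.real {s | ∀ Y ∈ lowRankOnGraphs (firstCols P kr hkr) (firstCols Q kc hkc),
      (1 - δ) * ‖Y‖ ^ 2 ≤
          (n * p : ℝ) / (ρr * ρc) * ‖rowSampling (ωr s) * Y * colSampling (ωc s)‖ ^ 2 ∧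
        (n * p : ℝ) / (ρr * ρc) * ‖rowSampling (ωr s) * Y * colSampling (ωc s)‖ ^ 2 ≤
          (1 + δ) * ‖Y‖ ^ 2} := by
  obtain ⟨hδ0, hδ1⟩ := hδ
  obtain ⟨hε0, hε1⟩ := hε
  have hbr := measureReal_not_isSamplingFrame_le (firstCols_transpose_mul_self hP.orthogonal hkr)
    hωr hδ0 hδ1 hε0 hε1 hρr
  have hbc := measureReal_not_isSamplingFrame_le (firstCols_transpose_mul_self hQ.orthogonal hkc)
    hωc hδ0 hδ1 hε0 hε1 hρc
  set Br := {s | ¬ IsSamplingFrame (colSpan (firstCols P kr hkr)) (1 - δ / 2) (1 + 0.414 * δ)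
    (ωr s)} with hBr
  set Bc := {s | ¬ IsSamplingFrame (colSpan (firstCols Q kc hkc)) (1 - δ / 2) (1 + 0.414 * δ)
    (ωc s)} with hBc
  set G := {s | ∀ Y ∈ lowRankOnGraphs (firstCols P kr hkr) (firstCols Q kc hkc),
      (1 - δ) * ‖Y‖ ^ 2 ≤
          (n * p : ℝ) / (ρr * ρc) * ‖rowSampling (ωr s) * Y * colSampling (ωc s)‖ ^ 2 ∧
        (n * p : ℝ) / (ρr * ρc) * ‖rowSampling (ωr s) * Y * colSampling (ωc s)‖ ^ 2 ≤
          (1 + δ) * ‖Y‖ ^ 2} with hG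
  -- A cover and subadditivity suffice, so measurability of these events is not needed.
  have hcover : Set.univ ⊆ G ∪ (Br ∪ Bc) := fun s _ => by
    by_cases hr : s ∈ Br
    · exact Or.inr (Or.inl hr)
    by_cases hc : s ∈ Bc
    · exact Or.inr (Or.inr hc)
    refine Or.inl fun Y hY => ?_
    obtain ⟨h1, h2⟩ := IsSamplingFrame.frobenius_bounds (by linarith) (by positivity)
      (not_not.1 hr) (not_not.1 hc) hY.1 hY.2
    -- Here `(1 - δ / 2) ^ 2 ≥ 1 - δ`, and `(1 + 0.414 * δ) ^ 2 ≤ 1 + δ` because `0.414 < √2 - 1`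
    -- and `δ < 1`.
    exact ⟨(mul_le_mul_of_nonneg_right (by nlinarith) (sq_nonneg _)).trans h1,
      h2.trans (mul_le_mul_of_nonneg_right (by nlinarith) (sq_nonneg _))⟩
  have h1 : (1 : ℝ) ≤ μ.real G + (μ.real Br + μ.real Bc) := by
    calc (1 : ℝ) = μ.real Set.univ := probReal_univ.symm
      _ ≤ μ.real (G ∪ (Br ∪ Bc)) := measureReal_mono hcover
      _ ≤ μ.real G + μ.real (Br ∪ Bc) := measureReal_union_le _ _
      _ ≤ _ := by gcongr; exact measureReal_union_le _ _
  linarith
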